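/- **Theorem 7.3.** For every integer $n\ge 1$, every $1<p<\infty$ and every $a\in\mathbb R$ there is a constant $C(n,p,a)>0$, depending only on $n$, $p$ and $a$, such that the following holds. Let $0<s<1$ and let $\omega$ be an $A_p$ weight in $\mathbb R^n$, that is, $\omega\in L^1_{\mathrm{loc}}(\mathbb R^n)$ is real-valued, $\omega>0$ almost everywhere, and there is $A>0$ with $$\Big(\frac1{|Q|}\int_Q\omega\,dx\Big)\Big(\frac1{|Q|}\int_Q\omega^{-1/(p-1)}\,dx\Big)^{p-1}\le A$$ for every cube $Q\subset\mathbb R^n$ with sides parallel to the axes; the infimum of such $A$ is denoted $[\omega]_{A_p}$. Let $0<\kappa<1$, let $G\subset\mathbb R^n$ be a bounded open set, and let $E\subset G$ be a nonempty compact set that is $\kappa$-porous: for each $x\in E$ and every $0<r<\mathrm{diam}(E)$ there is $y\in\mathbb R^n$ such that $B(y,\kappa r)\subset B(x,r)\setminus E$ (open balls). Let $R:G\to\mathbb R$ be continuous, with $R(x)=0$ for every $x\in E$ and $0\le R(x)\le\mathrm{dist}(x,\partial G)$ for every $x\in G$. For $t>0$ write $$E_t=\{x\in G:\mathrm{dist}(x,E)<t\},\qquad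 E_{t,R}=\{x\in G: R(x)<t\}.$$ For an open set $H$ with $E\subset H\subset G$ and a function $\rho:G\to\mathbb R$ that is $R$ or $0$, define $$\mathrm{cap}_{s,p,\omega,\rho}(E,H,G)=\inf_\varphi\int_G\int_G\frac{|\varphi(x)-\varphi(y)|^p}{(|x-y|+|\rho(x)-\rho(y)|)^{sp}}\,\omega(x-y)\,dy\,dx\in[0,\infty],$$ where the infimum is over all continuous $\varphi:G\to\mathbb R$ such that the closure in $\mathbb R^n$ of $\{x\in G:\varphi(x)\neq0\}$ is a compact subset of $G$, $\varphi\ge1$ on $E$, and $\varphi=0$ on $G\setminus H$. Write $\mathrm{cap}_{s,p,\omega}=\mathrm{cap}_{s,p,\omega,0}$. Then, whenever $0<t<\kappa\,\mathrm{diam}(E)/4$ is such that $\overline{E_t}\subset G$, $$\mathrm{cap}_{s,p,\omega,R}\big(E,\;E_t\cap E_{4t/\kappa,R},\;G\big)\le \kappa^{-np}\,C(n,p,[\omega]_{A_p})\;\mathrm{cap}_{s,p,\omega}(E,E_t,G).$$ -/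

import Mathlib

open MeasureTheory Set

noncomputable section

namespace FracCap

/-- Euclidean space of dimension `n`. -/
abbrev Rn (n : ℕ) : Type := EuclideanSpace ℝ (Fin n)

/-- The closed cube with sides parallel to the coordinate axes, centre `c` and side length
`2 * r`. -/
def cube {n : ℕ} (c : Rn n) (r : ℝ) : Set (Rn n) :=
  {x | ∀ i, |x i - c i| ≤ r}

/-- A weight: a locally integrable function that is positive almost everywhere. -/
def IsWeight {n : ℕ} (ω : Rn n → ℝ) : Prop :=
  LocallyIntegrable ω volume ∧ ∀ᵐ x ∂(volume : Measure (Rn n)), 0 < ω x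

/-- The inequality `(⨍_Q ω) (⨍_Q ω ^ (-1/(p-1))) ^ (p-1) ≤ A` for all cubes `Q`. The averages are
`[0,∞]`-valued, so the inequality contains the integrability of `ω ^ (-1/(p-1))` on cubes. -/
def ApBound {n : ℕ} (p : ℝ) (ω : Rn n → ℝ) (A : ℝ) : Prop :=
  ∀ (c : Rn n) (r : ℝ), 0 < r →
    (⨍⁻ x in cube c r, ENNReal.ofReal (ω x) ∂volume) *
      (⨍⁻ x in cube c r, ENNReal.ofReal (ω x) ^ (-(1 / (p - 1))) ∂volume) ^ (p - 1)
        ≤ ENNReal.ofReal A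

/-- Muckenhoupt `A_p` weights. -/
def IsApWeight {n : ℕ} (p : ℝ) (ω : Rn n → ℝ) : Prop :=
  IsWeight ω ∧ ∃ A : ℝ, 0 < A ∧ ApBound p ω A

/-- The `A_p` constant of a weight. -/
def apConst {n : ℕ} (p : ℝ) (ω : Rn n → ℝ) : ℝ :=
  sInf {A : ℝ | 0 < A ∧ ApBound p ω A}

/-- `κ`-porous sets. -/
def IsPorous {n : ℕ} (κ : ℝ) (E : Set (Rn n)) : Prop :=
  0 < κ ∧ κ < 1 ∧
    ∀ x ∈ E, ∀ r : ℝ, 0 < r → ENNReal.ofReal r < Metric.ediam E →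
      ∃ y : Rn n, Metric.ball y (κ * r) ⊆ Metric.ball x r \ E

/-- The set `{x ∈ G : R x < t}`. Functions on `G` are represented by total functions, whose values
outside `G` play no role. -/
def sublevel {n : ℕ} (G : Set (Rn n)) (R : Rn n → ℝ) (t : ℝ) : Set (Rn n) :=
  {x | x ∈ G ∧ R x < t}

/-- The `t`-neighbourhood `{x ∈ G : dist(x, E) < t}` of a nonempty set `E`. -/
def nbhd {n : ℕ} (G E : Set (Rn n)) (t : ℝ) : Set (Rn n) :=
  sublevel G (fun x => Metric.infDist x E) t

/-- `φ ∈ C_0(G)`: `φ` is continuous in `G`, and the closure in the whole space of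
`{x ∈ G : φ x ≠ 0}` is a compact set contained in `G`. -/
def MemC0 {n : ℕ} (G : Set (Rn n)) (φ : Rn n → ℝ) : Prop :=
  ContinuousOn φ G ∧ IsCompact (closure {x | x ∈ G ∧ φ x ≠ 0}) ∧
    closure {x | x ∈ G ∧ φ x ≠ 0} ⊆ G

/-- The `R`-modified fractional weighted energy
`∫_G ∫_G |φ x - φ y|^p / (|x - y| + |R x - R y|)^{sp} ω(x - y) dy dx`, with values in `[0,∞]`. -/
def energy {n : ℕ} (s p : ℝ) (ω R : Rn n → ℝ) (G : Set (Rn n)) (φ : Rn n → ℝ) : ENNReal :=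
  ∫⁻ x in G, ∫⁻ y in G,
    ENNReal.ofReal (|φ x - φ y| ^ p / (‖x - y‖ + |R x - R y|) ^ (s * p) * ω (x - y))

/-- The admissible test functions for the capacity of `E` in `H` relative to `G`. -/
def Admissible {n : ℕ} (E H G : Set (Rn n)) (φ : Rn n → ℝ) : Prop :=
  MemC0 G φ ∧ (∀ x ∈ E, 1 ≤ φ x) ∧ ∀ x ∈ G \ H, φ x = 0

/-- The `R`-modified relative capacity `cap_{s,p,ω,R}(E, H, G)`, for a compact set `E` contained
in an open set `H ⊆ G`. -/
def capR {n : ℕ} (s p : ℝ) (ω R : Rn n → ℝ) (E H G : Set (Rn n)) : ENNReal :=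
  ⨅ (φ : Rn n → ℝ) (_ : Admissible E H G φ), energy s p ω R G φ

/-- The relative capacity `cap_{s,p,ω}(E, H, G)`: the case `R = 0`. -/
def cap {n : ℕ} (s p : ℝ) (ω : Rn n → ℝ) (E H G : Set (Rn n)) : ENNReal :=
  capR s p ω (fun _ => 0) E H G

end FracCap

end

noncomputable section

namespace FracCap

variable {n : ℕ}

/-! Put `h = t / κ`. Any test function `φ` for the right-hand capacity becomes one for the left-hand
capacity after multiplication by a cutoff `ψ` in the variable `R`, equal to `1` for `R ≤ 3h` and `0`
for `R ≥ 4h`. It remains to bound the `R`-modified energy of `φψ` by the ordinary energy of `φ`.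

The product rule leaves the error `|φ(y)|^p |ψ(x) - ψ(y)|^p`. As `ψ` is bounded and `1/h`-Lipschitz
in `R`, dividing by the modified kernel leaves at most `|φ(y)|^p max(h, |x-y|)^(-sp)`: the
singularity is gone, which is what the term `|R x - R y|` buys. The error is needed only when one of
the points lies in `highPart`, the part of `E_t` where `R > 3h` (`integrand_mul_cutoff_le`).

There `R ≤ dist(·, ∂G)` keeps the ball of radius `3h` inside `G`, and porosity places in it a ball
of radius `t` missing `E_t` (`IsPorous.exists_ball_subset_diff_nbhd`). At scale `h` the truncated
kernel is essentially constant, and the `A_p` condition bounds the weight of a cube of size `h` by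
that of the hole, at a cost of order `κ^(-np)` (`cubeDoubling_of_apBound`). Hence the error integral
moves to the holes (`setLIntegral_kernel_le_of_holes`). Since `φ` vanishes there, `|φ(y)| = |φ(z) -
φ(y)|` for `z` in a hole, and the error is again part of the energy of `φ`. Averaging over all
translates of a cube takes the place of a covering argument. -/

/-! ### Coordinate cubes and averaging over their translates. -/

lemma norm_le_of_coord_le {x : Rn n} {r : ℝ} (hr : 0 ≤ r) (h : ∀ i, |x i| ≤ r) :
    ‖x‖ ≤ n * r := by
  have hn : (n : ℝ) ≤ (n : ℝ) ^ 2 := by exact_mod_cast Nat.le_self_pow two_ne_zero n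
  rw [EuclideanSpace.norm_eq]
  refine (Real.sqrt_le_left (by positivity)).2 ?_
  calc ∑ i, ‖x i‖ ^ 2 ≤ ∑ _i : Fin n, r ^ 2 :=
        Finset.sum_le_sum fun i _ => pow_le_pow_left₀ (norm_nonneg _) (h i) 2
    _ = n * r ^ 2 := by simp
    _ ≤ (n * r) ^ 2 := by rw [mul_pow]; gcongr

lemma abs_coord_le_norm (x : Rn n) (i : Fin n) : |x i| ≤ ‖x‖ := PiLp.norm_apply_le x i

lemma mem_cube_comm {x u : Rn n} {r : ℝ} : x ∈ cube u r ↔ u ∈ cube x r := by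
  simp only [cube, mem_ofPred_eq]
  exact forall_congr' fun i => by rw [abs_sub_comm]

lemma isClosed_setOf_mem_cube (r : ℝ) : IsClosed {q : Rn n × Rn n | q.2 ∈ cube q.1 r} := by
  have h : {q : Rn n × Rn n | q.2 ∈ cube q.1 r} =
      ⋂ i, {q : Rn n × Rn n | |q.2 i - q.1 i| ≤ r} := by
    ext q; simp [cube]
  rw [h]
  exact isClosed_iInter fun i => isClosed_le (by fun_prop) continuous_const

lemma measurableSet_cube (c : Rn n) (r : ℝ) : MeasurableSet (cube c r) := by
  have : IsClosed (cube c r) := by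
    simp only [cube, ofPred_forall]
    exact isClosed_iInter fun i => isClosed_le (by fun_prop) continuous_const
  exact this.measurableSet

lemma volume_cube (c : Rn n) (r : ℝ) : volume (cube c r) = ENNReal.ofReal (2 * r) ^ n := by
  have h : cube c r = WithLp.ofLp ⁻¹' (Set.pi univ fun i => Icc (c i - r) (c i + r)) := by
    ext x
    simp only [cube, mem_ofPred_eq, mem_preimage, mem_pi, mem_univ, true_implies, mem_Icc]
    exact forall_congr' fun i => by rw [abs_le]; constructor <;> intro h <;> constructor <;> linarith [h.1, h.2]
  rw [h, (PiLp.volume_preserving_ofLp (Fin n)).measure_preimage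
    (MeasurableSet.univ_pi fun i => measurableSet_Icc).nullMeasurableSet, volume_pi_pi]
  simp only [Real.volume_Icc]
  rw [Finset.prod_congr rfl (fun i _ => by rw [show c i + r - (c i - r) = 2 * r by ring])]
  simp

/-- Integrating a function over all translates of a cube. -/
lemma lintegral_lintegral_inter_cube {S : Set (Rn n)} (hS : MeasurableSet S) {f : Rn n → ENNReal}
    (hf : Measurable f) (r : ℝ) :
    ∫⁻ u, ∫⁻ x in S ∩ cube u r, f x = ENNReal.ofReal (2 * r) ^ n * ∫⁻ x in S, f x := by
  have hm : Measurable (Function.uncurry fun u x : Rn n =>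
      {q : Rn n × Rn n | q.2 ∈ cube q.1 r}.indicator (fun q => S.indicator f q.2) (u, x)) :=
    ((hf.indicator hS).comp measurable_snd).indicator (isClosed_setOf_mem_cube r).measurableSet
  calc ∫⁻ u, ∫⁻ x in S ∩ cube u r, f x
      = ∫⁻ u, ∫⁻ x, {q : Rn n × Rn n | q.2 ∈ cube q.1 r}.indicator
          (fun q => S.indicator f q.2) (u, x) := by
        refine lintegral_congr fun u => ?_
        rw [← lintegral_indicator (hS.inter (measurableSet_cube u r))]
        refine lintegral_congr fun x => ?_
        by_cases h1 : x ∈ S <;> by_cases h2 : x ∈ cube u r <;> simp [indicator, h1, h2]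
    _ = ∫⁻ x, ∫⁻ u, {q : Rn n × Rn n | q.2 ∈ cube q.1 r}.indicator
          (fun q => S.indicator f q.2) (u, x) := lintegral_lintegral_swap hm.aemeasurable
    _ = ∫⁻ x, ENNReal.ofReal (2 * r) ^ n * S.indicator f x := by
        refine lintegral_congr fun x => ?_
        rw [← volume_cube x r, mul_comm, ← lintegral_indicator_const (measurableSet_cube x r)]
        refine lintegral_congr fun u => ?_
        have e : (u, x) ∈ {q : Rn n × Rn n | q.2 ∈ cube q.1 r} ↔ u ∈ cube x r := mem_cube_comm
        by_cases h2 : u ∈ cube x r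
        · rw [indicator_of_mem (e.2 h2), indicator_of_mem h2]
        · rw [indicator_of_notMem (mt e.1 h2), indicator_of_notMem h2]
    _ = _ := by
        rw [lintegral_const_mul _ (hf.indicator hS), lintegral_indicator hS]

/-- Integrate the local estimate over all centres `u`. By Tonelli each side becomes the full
integral times the volume of a cube, and the two volumes differ by the factor `4 ^ n`. -/
lemma setLIntegral_le_of_forall_cube {D H : Set (Rn n)} (hD : MeasurableSet D)
    (hH : MeasurableSet H) {f g : Rn n → ENNReal} (hf : Measurable f) (hg : Measurable g)
    {h : ℝ} (hh : 0 < h) {C : ENNReal}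
    (hfg : ∀ u, ∫⁻ x in D ∩ cube u h, f x ≤ C * ∫⁻ z in H ∩ cube u (4 * h), g z) (hC : C ≠ ⊤) :
    ∫⁻ x in D, f x ≤ C * 4 ^ n * ∫⁻ z in H, g z := by
  have h1 := lintegral_mono (μ := volume) hfg
  rw [lintegral_lintegral_inter_cube hD hf, lintegral_const_mul' _ _ hC,
    lintegral_lintegral_inter_cube hH hg,
    show 2 * (4 * h) = (2 * h) * 4 by ring,
    ENNReal.ofReal_mul (p := 2 * h) (by positivity), mul_pow] at h1
  have h0 : ENNReal.ofReal (2 * h) ^ n ≠ 0 := by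
    apply pow_ne_zero; simpa using hh
  have ht : ENNReal.ofReal (2 * h) ^ n ≠ ⊤ := ENNReal.pow_ne_top ENNReal.ofReal_ne_top
  rw [← ENNReal.mul_le_mul_iff_right h0 ht]
  refine h1.trans_eq ?_
  simp only [ENNReal.ofReal_ofNat]
  ring

/-! ### Doubling of `A_p` weights. -/

/-- The mass of a cube is controlled by the mass of each subcube, with the polynomial rate
of an `A_p` weight. -/
def CubeDoubling (p A : ℝ) (w : Rn n → ENNReal) : Prop :=
  ∀ (c c' : Rn n) (r r' : ℝ), 0 < r → 0 < r' → cube c' r' ⊆ cube c r →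
    ∫⁻ x in cube c r, w x ≤ ENNReal.ofReal (A * ((r / r') ^ n) ^ p) * ∫⁻ x in cube c' r', w x

lemma CubeDoubling.congr_ae {p A : ℝ} {w w' : Rn n → ENNReal} (hw : CubeDoubling p A w)
    (h : w =ᵐ[volume] w') : CubeDoubling p A w' := by
  intro c c' r r' hr hr' hsub
  have := hw c c' r r' hr hr' hsub
  rwa [lintegral_congr_ae (ae_restrict_of_ae h), lintegral_congr_ae (ae_restrict_of_ae h)] at this

lemma CubeDoubling.comp_sub_right {p A : ℝ} {w : Rn n → ENNReal} (hw : CubeDoubling p A w)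
    (y : Rn n) : CubeDoubling p A (fun x => w (x - y)) := by
  have key : ∀ (c : Rn n) (r : ℝ), ∫⁻ x in cube c r, w (x - y) = ∫⁻ x in cube (c - y) r, w x := by
    intro c r
    rw [← lintegral_indicator (measurableSet_cube _ _), ← lintegral_indicator (measurableSet_cube _ _),
      ← lintegral_sub_right_eq_self ((cube (c - y) r).indicator w) y]
    refine lintegral_congr fun x => ?_
    have e : x - y ∈ cube (c - y) r ↔ x ∈ cube c r := by simp [cube]
    by_cases hx : x ∈ cube c r
    · rw [indicator_of_mem hx, indicator_of_mem (e.2 hx)]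
    · rw [indicator_of_notMem hx, indicator_of_notMem (mt e.1 hx)]
  intro c c' r r' hr hr' hsub
  rw [key, key]
  refine hw _ _ r r' hr hr' fun x hx => ?_
  have := @hsub (x + y) (by simpa [cube, sub_sub_eq_add_sub] using hx)
  simpa [cube, sub_sub_eq_add_sub] using this

/-- The weight is not assumed even, so the error terms in `x` and in `y` need translation and
reflection separately. -/
lemma CubeDoubling.comp_sub_left {p A : ℝ} {w : Rn n → ENNReal} (hw : CubeDoubling p A w)
    (y : Rn n) : CubeDoubling p A (fun x => w (y - x)) := by
  have key : ∀ (c : Rn n) (r : ℝ), ∫⁻ x in cube c r, w (y - x) = ∫⁻ x in cube (y - c) r, w x := by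
    intro c r
    rw [← lintegral_indicator (measurableSet_cube _ _), ← lintegral_indicator (measurableSet_cube _ _),
      ← lintegral_sub_left_eq_self ((cube (y - c) r).indicator w) y]
    refine lintegral_congr fun x => ?_
    have e : y - x ∈ cube (y - c) r ↔ x ∈ cube c r := by
      rw [mem_cube_comm (x := x)]; simp [cube]
    by_cases hx : x ∈ cube c r
    · rw [indicator_of_mem hx, indicator_of_mem (e.2 hx)]
    · rw [indicator_of_notMem hx, indicator_of_notMem (mt e.1 hx)]
  intro c c' r r' hr hr' hsub
  rw [key, key]
  refine hw _ _ r r' hr hr' fun x hx => ?_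
  have e' : ∀ (a b c : ℝ), |a - b - c| = |b - (a - c)| := fun a b c => by
    rw [← abs_neg]; congr 1; ring
  have := @hsub (y - x) (by simpa [cube, e'] using hx)
  simpa [cube, e'] using this

/-- Hölder's inequality for `1 = w ^ (1/p) * w ^ (-(1/p))`. -/
lemma volume_rpow_le_of_weight {p : ℝ} (hp : 1 < p) {w : Rn n → ENNReal} (hm : AEMeasurable w)
    (h0 : ∀ᵐ x, w x ≠ 0) (ht : ∀ x, w x ≠ ⊤) (q : Set (Rn n)) :
    volume q ^ p ≤ (∫⁻ x in q, w x) * (∫⁻ x in q, w x ^ (-(1 / (p - 1)))) ^ (p - 1) := by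
  have hp0 : 0 < p := by linarith
  have hp1 : 0 < p - 1 := by linarith
  have hc : p.HolderConjugate (p / (p - 1)) := Real.HolderConjugate.conjExponent hp
  have hH := ENNReal.lintegral_mul_le_Lp_mul_Lq (volume.restrict q) hc
    (f := fun x => w x ^ (1 / p)) (g := fun x => w x ^ (-(1 / p)))
    (hm.restrict.pow_const _) (hm.restrict.pow_const _)
  have e1 : ∫⁻ x in q, ((fun x => w x ^ (1 / p)) * fun x => w x ^ (-(1 / p))) x = volume q := by
    rw [← setLIntegral_one]
    refine lintegral_congr_ae (ae_restrict_of_ae (h0.mono fun x hx => ?_))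
    simp only [Pi.mul_apply]
    rw [← ENNReal.rpow_add _ _ hx (ht x)]; simp
  have e2 : ∀ x, (w x ^ (1 / p)) ^ p = w x := fun x => by
    rw [← ENNReal.rpow_mul, one_div_mul_cancel hp0.ne', ENNReal.rpow_one]
  have e3 : ∀ x, (w x ^ (-(1 / p))) ^ (p / (p - 1)) = w x ^ (-(1 / (p - 1))) := fun x => by
    rw [← ENNReal.rpow_mul]; congr 1; field_simp
  simp only [e1, e2, e3] at hH
  calc volume q ^ p ≤ _ := ENNReal.rpow_le_rpow hH hp0.le
    _ = _ := by
      rw [ENNReal.mul_rpow_of_nonneg _ _ hp0.le, ← ENNReal.rpow_mul, ← ENNReal.rpow_mul,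
        one_div_mul_cancel hp0.ne', ENNReal.rpow_one]
      congr 2; field_simp

/-- Hölder on the small cube bounds its volume from above; enlarging the domain of the dual weight
`w ^ (-(1/(p-1)))` to the large cube then lets the `A_p` bound apply there. -/
lemma cubeDoubling_of_apBound {p A : ℝ} (hp : 1 < p) (hA : 0 < A) {ω : Rn n → ℝ}
    (hω : IsWeight ω) (h : ApBound p ω A) : CubeDoubling p A fun x => ENNReal.ofReal (ω x) := by
  intro c c' r r' hr hr' hsub
  have hp1 : 0 < p - 1 := by linarith
  set w : Rn n → ENNReal := fun x => ENNReal.ofReal (ω x) with hw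
  have hvol : ∀ (c : Rn n) {r : ℝ}, 0 < r → volume (cube c r) ≠ 0 ∧ volume (cube c r) ≠ ⊤ := by
    intro c r hr
    rw [volume_cube]
    exact ⟨pow_ne_zero _ (by simpa using hr), ENNReal.pow_ne_top ENNReal.ofReal_ne_top⟩
  have hm : AEMeasurable w := hω.1.aestronglyMeasurable.aemeasurable.ennreal_ofReal
  have h1 := volume_rpow_le_of_weight hp hm (hω.2.mono fun x hx => by simpa [hw] using hx)
    (fun x => ENNReal.ofReal_ne_top) (cube c' r')
  have h2 := h c r hr
  obtain ⟨hQ0, hQt⟩ := hvol c hr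
  obtain ⟨hq0, hqt⟩ := hvol c' hr'
  have h3 : (∫⁻ x in cube c r, w x) * (∫⁻ x in cube c r, w x ^ (-(1 / (p - 1)))) ^ (p - 1) ≤
      ENNReal.ofReal A * volume (cube c r) ^ p := by
    rw [setLAverage_eq, setLAverage_eq, ENNReal.div_rpow_of_nonneg _ _ hp1.le,
      ENNReal.div_eq_inv_mul, ENNReal.div_eq_inv_mul] at h2
    have e : volume (cube c r) ^ p = volume (cube c r) * volume (cube c r) ^ (p - 1) := by
      conv_lhs => rw [show p = 1 + (p - 1) by ring, ENNReal.rpow_add _ _ hQ0 hQt, ENNReal.rpow_one]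
    have hP0 : volume (cube c r) ^ (p - 1) ≠ 0 := by
      simp [ENNReal.rpow_eq_zero_iff, hQ0, hQt]
    have hPt : volume (cube c r) ^ (p - 1) ≠ ⊤ := ENNReal.rpow_ne_top_of_nonneg hp1.le hQt
    rw [e]
    calc _ = (volume (cube c r) * (volume (cube c r))⁻¹) *
          (volume (cube c r) ^ (p - 1) * (volume (cube c r) ^ (p - 1))⁻¹) *
          ((∫⁻ x in cube c r, w x) * (∫⁻ x in cube c r, w x ^ (-(1 / (p - 1)))) ^ (p - 1)) := by
          rw [ENNReal.mul_inv_cancel hQ0 hQt, ENNReal.mul_inv_cancel hP0 hPt]; simp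
      _ = (volume (cube c r) * volume (cube c r) ^ (p - 1)) * _ := by
          rw [show ∀ a a' b b' x y : ENNReal, (a * a') * (b * b') * (x * y) =
            (a * b) * ((a' * x) * (b' * y)) by intros; ring]
      _ ≤ (volume (cube c r) * volume (cube c r) ^ (p - 1)) * ENNReal.ofReal A := by gcongr
      _ = _ := by ring
  have hv : volume (cube c r) ^ p =
      ENNReal.ofReal (((r / r') ^ n) ^ p) * volume (cube c' r') ^ p := by
    rw [← ENNReal.ofReal_rpow_of_nonneg (by positivity) (by linarith),
      ← ENNReal.mul_rpow_of_nonneg _ _ (by linarith), volume_cube, volume_cube,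
      ENNReal.ofReal_pow (by positivity), ← mul_pow, ← ENNReal.ofReal_mul (by positivity)]
    congr 3; field_simp
  have hqp0 : volume (cube c' r') ^ p ≠ 0 := by simp [ENNReal.rpow_eq_zero_iff, hq0, hqt]
  have hqpt : volume (cube c' r') ^ p ≠ ⊤ := ENNReal.rpow_ne_top_of_nonneg (by linarith) hqt
  rw [← ENNReal.mul_le_mul_iff_right hqp0 hqpt]
  calc volume (cube c' r') ^ p * ∫⁻ x in cube c r, w x
      ≤ ((∫⁻ x in cube c' r', w x) * (∫⁻ x in cube c r, w x ^ (-(1 / (p - 1)))) ^ (p - 1)) *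
        ∫⁻ x in cube c r, w x := by
        gcongr
        exact h1.trans (by gcongr)
    _ = (∫⁻ x in cube c' r', w x) * ((∫⁻ x in cube c r, w x) *
        (∫⁻ x in cube c r, w x ^ (-(1 / (p - 1)))) ^ (p - 1)) := by ring
    _ ≤ (∫⁻ x in cube c' r', w x) * (ENNReal.ofReal A * volume (cube c r) ^ p) := by gcongr
    _ = _ := by
        rw [hv, ENNReal.ofReal_mul hA.le]; ring

/-! ### Holes supplied by porosity. -/

/-- The ball is connected, meets `G` and avoids the frontier. If the frontier is empty, `infDist`
takes the value `0` and the ball is empty. -/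
lemma ball_infDist_frontier_subset {V : Type*} [NormedAddCommGroup V] [NormedSpace ℝ V]
    {G : Set V} (hG : IsOpen G) {x : V} (hx : x ∈ G) :
    Metric.ball x (Metric.infDist x (frontier G)) ⊆ G := by
  intro z hz
  have hpos : 0 < Metric.infDist x (frontier G) := dist_nonneg.trans_lt hz
  refine IsPreconnected.subset_left_of_subset_union hG (v := (closure G)ᶜ)
    isClosed_closure.isOpen_compl
    (disjoint_left.2 fun a ha hb => hb (subset_closure ha)) ?_ ⟨x, Metric.mem_ball_self hpos, hx⟩
    (convex_ball x _).isPreconnected hz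
  intro a ha
  by_cases haG : a ∈ G
  · exact Or.inl haG
  · refine Or.inr fun hac => ?_
    have haf : a ∈ frontier G := ⟨hac, by rwa [hG.interior_eq]⟩
    have h1 := Metric.infDist_le_dist_of_mem (x := x) haf
    rw [Metric.mem_ball, dist_comm] at ha
    linarith

/-- Points of the neighbourhood `nbhd G E t` at which `R` is large have a hole nearby, which
lies in `G` and outside `nbhd G E t`. -/
lemma IsPorous.exists_ball_subset_diff_nbhd {κ t : ℝ} {E G : Set (Rn n)} (hE : IsPorous κ E)
    (hne : E.Nonempty) (hc : IsCompact E) (hG : IsOpen G) (ht : 0 < t)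
    (htd : t < κ * Metric.diam E / 4) {x : Rn n} (hx : x ∈ nbhd G E t)
    (hR : 3 * (t / κ) < Metric.infDist x (frontier G)) :
    ∃ c, ∀ z ∈ Metric.ball c t, z ∈ G \ nbhd G E t ∧ dist z x < 3 * (t / κ) := by
  obtain ⟨hκ, hκ1, hp⟩ := hE
  obtain ⟨e, heE, he⟩ := (Metric.infDist_lt_iff hne).1 hx.2
  have hκt : κ * (t / κ) = t := by field_simp
  have hth : t ≤ t / κ := by rw [le_div_iff₀ hκ]; nlinarith
  have hd : 2 * (t / κ) < Metric.diam E := by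
    have : t / κ < Metric.diam E / 4 := by rw [div_lt_iff₀ hκ]; linarith
    have : 0 < t / κ := by positivity
    linarith
  -- Radius `2t/κ` gives a hole of radius `2t`, so its concentric ball of radius `t` stays at
  -- distance at least `t` from `E`, hence outside `E_t`.
  obtain ⟨c, hc'⟩ := hp e heE (2 * (t / κ)) (by positivity) (by
    rw [← ENNReal.ofReal_toReal hc.isBounded.ediam_ne_top]
    exact (ENNReal.ofReal_lt_ofReal_iff ((show 0 < 2 * (t / κ) by positivity).trans hd)).2 hd)
  rw [show κ * (2 * (t / κ)) = 2 * t by linarith] at hc'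
  refine ⟨c, fun z hz => ?_⟩
  rw [Metric.mem_ball] at hz
  have hze : dist z e < 2 * (t / κ) := (hc' (Metric.mem_ball.2 (by linarith))).1
  have hzx : dist z x < 3 * (t / κ) := by
    have := dist_triangle z e x
    rw [dist_comm e x] at this
    linarith
  refine ⟨⟨ball_infDist_frontier_subset hG hx.1 (Metric.mem_ball.2 (hzx.trans hR)), fun hzE => ?_⟩, hzx⟩
  obtain ⟨e', he'E, he'⟩ := (Metric.infDist_lt_iff hne).1 hzE.2
  refine (hc' (Metric.mem_ball.2 ?_)).2 he'E
  have := dist_triangle e' z c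
  rw [dist_comm e' z] at this
  linarith

/-! ### Moving the truncated kernel to the holes. -/

lemma inv_rpow_le_mul_inv_rpow {q p a b B : ℝ} (hq : 0 ≤ q) (hqp : q ≤ p) (ha : 0 < a)
    (hb : 0 < b) (hB : 1 ≤ B) (h : b ≤ B * a) : (a ^ q)⁻¹ ≤ B ^ p * (b ^ q)⁻¹ := by
  have h1 : b ^ q ≤ B ^ p * a ^ q := calc
    b ^ q ≤ (B * a) ^ q := Real.rpow_le_rpow hb.le h hq
    _ = B ^ q * a ^ q := Real.mul_rpow (by linarith) ha.le
    _ ≤ B ^ p * a ^ q := by gcongr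
  have ha' : 0 < a ^ q := Real.rpow_pos_of_pos ha q
  have hb' : 0 < b ^ q := Real.rpow_pos_of_pos hb q
  rw [← div_eq_mul_inv, inv_eq_one_div, div_le_div_iff₀ ha' hb']
  linarith

/-- The factor lost when an integral of a doubling weight is moved to nearby holes. -/
def holeConst (n : ℕ) (p A κ : ℝ) : ℝ :=
  (n + 1 : ℝ) ^ p * (4 * n + 1 : ℝ) ^ p * (A * ((4 * (n + 1) / κ) ^ n) ^ p)

lemma setLIntegral_kernel_le_of_holes {q p A κ t : ℝ} (hq : 0 ≤ q) (hqp : q ≤ p)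
    (hκ : 0 < κ) (hκ1 : κ ≤ 1) (ht : 0 < t) {w : Rn n → ENNReal} (hw : Measurable w)
    (hdb : CubeDoubling p A w) {D H : Set (Rn n)} (hD : MeasurableSet D) (hH : MeasurableSet H)
    (hDH : ∀ x ∈ D, ∃ c, ∀ z ∈ Metric.ball c t, z ∈ H ∧ dist z x < 3 * (t / κ))
    {y : Rn n} (hy : y ∉ H) :
    ∫⁻ x in D, ENNReal.ofReal ((max (t / κ) ‖x - y‖) ^ q)⁻¹ * w x ≤
      ENNReal.ofReal (holeConst n p A κ) * 4 ^ n *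
        ∫⁻ z in H, ENNReal.ofReal (‖z - y‖ ^ q)⁻¹ * w z := by
  set h := t / κ with hh
  have hh0 : 0 < h := by positivity
  have hth : t ≤ h := by rw [hh, le_div_iff₀ hκ]; nlinarith
  refine setLIntegral_le_of_forall_cube hD hH (by fun_prop) (by fun_prop) hh0 (fun u => ?_)
    ENNReal.ofReal_ne_top
  rcases (D ∩ cube u h).eq_empty_or_nonempty with hemp | ⟨x₀, hx₀D, hx₀u⟩
  · simp [hemp]
  obtain ⟨c, hc⟩ := hDH x₀ hx₀D
  -- A cube small enough to fit inside the open ball of radius `t`; `n + 1` also covers `n = 0`.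
  set ρ := t / (n + 1) with hρ
  have hρ0 : 0 < ρ := by positivity
  have hcube : cube c ρ ⊆ Metric.ball c t := by
    intro z hz
    rw [Metric.mem_ball, dist_eq_norm]
    calc ‖z - c‖ ≤ n * ρ := norm_le_of_coord_le hρ0.le hz
      _ < (n + 1) * ρ := by nlinarith
      _ = t := by rw [hρ]; field_simp
  have hcube' : cube c ρ ⊆ cube u (4 * h) := by
    intro z hz i
    have h1 : |z i - x₀ i| ≤ dist z x₀ := by
      rw [dist_eq_norm]; exact abs_coord_le_norm (z - x₀) i
    have h2 := (hc z (hcube hz)).2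
    have h3 := hx₀u i
    have h4 := abs_sub_le (z i) (x₀ i) (u i)
    linarith
  -- The kernel is frozen at `m`. Only upper bounds for distances are needed: `m ≤ (n + 1) max(h,
  -- |x-y|)` near `x`, and `|z-y| ≤ (4n + 1) m` in the hole.
  set m := max h ‖u - y‖ with hm
  have hm0 : 0 < m := lt_max_of_lt_left hh0
  have hnear : ∀ x ∈ D ∩ cube u h, ENNReal.ofReal ((max h ‖x - y‖) ^ q)⁻¹ * w x ≤
      ENNReal.ofReal ((n + 1 : ℝ) ^ p * (m ^ q)⁻¹) * w x := by
    intro x hx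
    gcongr
    refine inv_rpow_le_mul_inv_rpow hq hqp (lt_max_of_lt_left hh0) hm0 (by simp) ?_
    have h1 : ‖u - y‖ ≤ ‖x - u‖ + ‖x - y‖ := by
      rw [norm_sub_rev x u]; exact norm_sub_le_norm_sub_add_norm_sub u x y
    have h2 : ‖x - u‖ ≤ n * h := norm_le_of_coord_le hh0.le hx.2
    have h3 := le_max_left h ‖x - y‖
    have h4 := le_max_right h ‖x - y‖
    have h5 : (n : ℝ) * h ≤ n * max h ‖x - y‖ := by gcongr
    refine max_le ?_ ?_ <;> nlinarith [show (0 : ℝ) ≤ n from Nat.cast_nonneg n]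
  have hfar : ∀ z ∈ cube c ρ, ENNReal.ofReal (m ^ q)⁻¹ * w z ≤
      ENNReal.ofReal ((4 * n + 1 : ℝ) ^ p) * (ENNReal.ofReal (‖z - y‖ ^ q)⁻¹ * w z) := by
    intro z hz
    rw [← mul_assoc, ← ENNReal.ofReal_mul (by positivity)]
    gcongr
    have hzy : z ≠ y := fun h => hy (h ▸ (hc z (hcube hz)).1)
    refine inv_rpow_le_mul_inv_rpow hq hqp hm0 (norm_pos_iff.2 (sub_ne_zero.2 hzy))
      (by simp) ?_
    have h1 : ‖z - y‖ ≤ ‖z - u‖ + ‖u - y‖ := norm_sub_le_norm_sub_add_norm_sub z u y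
    have h2 : ‖z - u‖ ≤ n * (4 * h) := norm_le_of_coord_le (by positivity) (hcube' hz)
    have h3 := le_max_left h ‖u - y‖
    have h4 := le_max_right h ‖u - y‖
    have h5 : (n : ℝ) * h ≤ n * m := by gcongr
    linarith
  have hratio : 4 * h / ρ = 4 * (n + 1) / κ := by
    rw [hh, hρ]; field_simp
  calc ∫⁻ x in D ∩ cube u h, ENNReal.ofReal ((max h ‖x - y‖) ^ q)⁻¹ * w x
      ≤ ∫⁻ x in D ∩ cube u h, ENNReal.ofReal ((n + 1 : ℝ) ^ p * (m ^ q)⁻¹) * w x :=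
        setLIntegral_mono' (hD.inter (measurableSet_cube _ _)) hnear
    _ ≤ ∫⁻ x in cube u (4 * h), ENNReal.ofReal ((n + 1 : ℝ) ^ p * (m ^ q)⁻¹) * w x :=
        lintegral_mono_set fun x hx i => (hx.2 i).trans (by linarith)
    _ = ENNReal.ofReal ((n + 1 : ℝ) ^ p * (m ^ q)⁻¹) * ∫⁻ x in cube u (4 * h), w x :=
        lintegral_const_mul _ hw
    _ ≤ ENNReal.ofReal ((n + 1 : ℝ) ^ p * (m ^ q)⁻¹) *
        (ENNReal.ofReal (A * ((4 * (n + 1) / κ) ^ n) ^ p) * ∫⁻ x in cube c ρ, w x) := by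
        gcongr
        rw [← hratio]
        exact hdb u c (4 * h) ρ (by positivity) hρ0 hcube'
    _ = ENNReal.ofReal ((n + 1 : ℝ) ^ p) * ENNReal.ofReal (A * ((4 * (n + 1) / κ) ^ n) ^ p) *
        ∫⁻ x in cube c ρ, ENNReal.ofReal (m ^ q)⁻¹ * w x := by
        rw [lintegral_const_mul _ hw, ENNReal.ofReal_mul (by positivity)]; ring
    _ ≤ ENNReal.ofReal ((n + 1 : ℝ) ^ p) * ENNReal.ofReal (A * ((4 * (n + 1) / κ) ^ n) ^ p) *
        ∫⁻ z in cube c ρ, ENNReal.ofReal ((4 * n + 1 : ℝ) ^ p) *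
          (ENNReal.ofReal (‖z - y‖ ^ q)⁻¹ * w z) := by
        gcongr _ * ?_
        exact setLIntegral_mono' (measurableSet_cube _ _) hfar
    _ = ENNReal.ofReal (holeConst n p A κ) *
        ∫⁻ z in cube c ρ, ENNReal.ofReal (‖z - y‖ ^ q)⁻¹ * w z := by
        rw [lintegral_const_mul _ (by fun_prop), holeConst,
          ENNReal.ofReal_mul (p := (n + 1 : ℝ) ^ p * (4 * n + 1 : ℝ) ^ p) (by positivity),
          ENNReal.ofReal_mul (p := (n + 1 : ℝ) ^ p) (by positivity)]
        ring
    _ ≤ _ := by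
        gcongr _ * ?_
        exact lintegral_mono_set fun z hz => ⟨(hc z (hcube hz)).1, hcube' hz⟩

/-! ### The cutoff and pointwise inequalities. -/

/-- Since `τ ≤ 1` and `q ≤ p`, `τ ^ p ≤ τ ^ q`; and `τ * max h d ≤ d + δ`, from `τ * h ≤ δ` or from
`τ * d ≤ d`. It is applied with `q = s * p` and `τ` the increment of the cutoff. -/
lemma rpow_div_rpow_le_of_lipschitz {q p h d δ τ : ℝ} (hq : 0 < q) (hqp : q ≤ p) (hh : 0 < h)
    (hd : 0 ≤ d) (hδ : 0 ≤ δ) (hτ : 0 ≤ τ) (hτ1 : τ ≤ 1) (hτδ : τ * h ≤ δ) :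
    τ ^ p / (d + δ) ^ q ≤ ((max h d) ^ q)⁻¹ := by
  have hm : 0 < (max h d) ^ q := Real.rpow_pos_of_pos (lt_max_of_lt_left hh) q
  rcases (add_nonneg hd hδ).eq_or_lt with h0 | h0
  · rw [← h0, Real.zero_rpow hq.ne', div_zero]; positivity
  rw [inv_eq_one_div, div_le_div_iff₀ (Real.rpow_pos_of_pos h0 q) hm, one_mul]
  calc τ ^ p * max h d ^ q ≤ τ ^ q * max h d ^ q := by
        gcongr ?_ * _
        exact Real.rpow_le_rpow_of_exponent_ge' hτ hτ1 hq.le hqp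
    _ = (τ * max h d) ^ q := (Real.mul_rpow hτ (le_max_of_le_left hh.le)).symm
    _ ≤ (d + δ) ^ q := by
        refine Real.rpow_le_rpow (by positivity) ?_ hq.le
        rcases max_choice h d with e | e <;> rw [e] <;> nlinarith

lemma add_rpow_le_two_rpow_mul {p u v : ℝ} (hp : 0 ≤ p) (hu : 0 ≤ u) (hv : 0 ≤ v) :
    (u + v) ^ p ≤ 2 ^ p * (u ^ p + v ^ p) := calc
  (u + v) ^ p ≤ (2 * max u v) ^ p := Real.rpow_le_rpow (by positivity)
      (by linarith [le_max_left u v, le_max_right u v]) hp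
  _ = 2 ^ p * (max u v) ^ p := Real.mul_rpow zero_le_two (le_max_of_le_left hu)
  _ ≤ _ := by
      have h1 := Real.rpow_nonneg hu p
      have h2 := Real.rpow_nonneg hv p
      gcongr
      rcases max_choice u v with e | e <;> rw [e] <;> linarith

lemma rpow_abs_sub_mul_div_le {q p h d δ a b α β : ℝ} (hq : 0 < q) (hqp : q ≤ p) (hp0 : 0 < p)
    (hh : 0 < h) (hd : 0 ≤ d) (hδ : 0 ≤ δ) (hab : d = 0 → a = b) (hα : 0 ≤ α) (hα1 : α ≤ 1)
    (hαβ1 : |α - β| ≤ 1) (hαβ : |α - β| * h ≤ δ) :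
    |a * α - b * β| ^ p / (d + δ) ^ q ≤
      2 ^ p * (|a - b| ^ p / d ^ q + |b| ^ p * ((max h d) ^ q)⁻¹) := by
  have h1 : |a * α - b * β| ≤ |a - b| + |b| * |α - β| := calc
    _ = |(a - b) * α + b * (α - β)| := by congr 1; ring
    _ ≤ |a - b| * |α| + |b| * |α - β| := by
      rw [← abs_mul, ← abs_mul]; exact abs_add_le _ _
    _ ≤ _ := by
      rw [abs_of_nonneg hα]
      nlinarith [abs_nonneg (a - b)]
  have h2 : |a * α - b * β| ^ p ≤ 2 ^ p * (|a - b| ^ p + |b| ^ p * |α - β| ^ p) := calc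
    _ ≤ (|a - b| + |b| * |α - β|) ^ p := Real.rpow_le_rpow (abs_nonneg _) h1 hp0.le
    _ ≤ 2 ^ p * (|a - b| ^ p + (|b| * |α - β|) ^ p) :=
      add_rpow_le_two_rpow_mul hp0.le (abs_nonneg _) (by positivity)
    _ = 2 ^ p * (|a - b| ^ p + |b| ^ p * |α - β| ^ p) := by
      rw [Real.mul_rpow (abs_nonneg _) (abs_nonneg _)]
  have h3 : |a - b| ^ p / (d + δ) ^ q ≤ |a - b| ^ p / d ^ q := by
    rcases hd.eq_or_lt with h0 | h0
    · rw [hab h0.symm]; simp [Real.zero_rpow hp0.ne']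
    · gcongr; linarith
  calc |a * α - b * β| ^ p / (d + δ) ^ q
      ≤ 2 ^ p * (|a - b| ^ p + |b| ^ p * |α - β| ^ p) / (d + δ) ^ q := by gcongr
    _ = 2 ^ p * (|a - b| ^ p / (d + δ) ^ q + |b| ^ p * (|α - β| ^ p / (d + δ) ^ q)) := by ring
    _ ≤ _ := by
      gcongr
      exact rpow_div_rpow_le_of_lipschitz hq hqp hh hd hδ (abs_nonneg _) hαβ1 hαβ

/-- The piecewise linear cutoff that is `1` on `(-∞, 3 h]` and `0` on `[4 h, ∞)`. -/
def cutoff (h r : ℝ) : ℝ := max 0 (min 1 (4 - r / h))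

lemma cutoff_nonneg (h r : ℝ) : 0 ≤ cutoff h r := le_max_left _ _

lemma cutoff_le_one (h r : ℝ) : cutoff h r ≤ 1 := max_le zero_le_one (min_le_left _ _)

lemma continuous_cutoff (h : ℝ) : Continuous (cutoff h) := by unfold cutoff; fun_prop

lemma cutoff_eq_one {h r : ℝ} (hh : 0 < h) (hr : r ≤ 3 * h) : cutoff h r = 1 := by
  have : r / h ≤ 3 := by rwa [div_le_iff₀ hh]
  rw [cutoff, min_eq_left (by linarith), max_eq_right zero_le_one]

lemma cutoff_eq_zero {h r : ℝ} (hh : 0 < h) (hr : 4 * h ≤ r) : cutoff h r = 0 := by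
  have : 4 ≤ r / h := by rwa [le_div_iff₀ hh]
  rw [cutoff, max_eq_left ((min_le_right _ _).trans (by linarith))]

lemma abs_cutoff_sub_le_one (h r r' : ℝ) : |cutoff h r - cutoff h r'| ≤ 1 := by
  rw [abs_le]
  constructor <;> linarith [cutoff_nonneg h r, cutoff_nonneg h r', cutoff_le_one h r,
    cutoff_le_one h r']

lemma abs_cutoff_sub_mul_le {h : ℝ} (hh : 0 < h) (r r' : ℝ) :
    |cutoff h r - cutoff h r'| * h ≤ |r - r'| := by
  have h1 : |cutoff h r - cutoff h r'| ≤ |(4 - r / h) - (4 - r' / h)| := by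
    refine (abs_max_sub_max_le_max _ _ _ _).trans (max_le (by simp) ?_)
    exact (abs_min_sub_min_le_max _ _ _ _).trans (max_le (by simp) le_rfl)
  rw [← le_div_iff₀ hh]
  refine h1.trans_eq ?_
  rw [show (4 - r / h) - (4 - r' / h) = -((r - r') / h) by ring, abs_neg, abs_div, abs_of_pos hh]

/-! ### Energy of the truncated test function. -/

lemma energy_zero_eq (s p : ℝ) (ω : Rn n → ℝ) (G : Set (Rn n)) (φ : Rn n → ℝ) :
    energy s p ω (fun _ => 0) G φ = ∫⁻ x in G, ∫⁻ y in G,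
      ENNReal.ofReal (|φ x - φ y| ^ p / ‖x - y‖ ^ (s * p)) * ENNReal.ofReal (ω (x - y)) := by
  refine lintegral_congr fun x => lintegral_congr fun y => ?_
  rw [← ENNReal.ofReal_mul (by positivity)]
  simp

lemma energy_congr_fun (s p : ℝ) (ω R : Rn n → ℝ) {G : Set (Rn n)} (hG : MeasurableSet G)
    {φ φ' : Rn n → ℝ} (h : EqOn φ φ' G) : energy s p ω R G φ = energy s p ω R G φ' :=
  setLIntegral_congr_fun hG fun x hx => setLIntegral_congr_fun hG fun y hy => by
    simp only [h hx, h hy]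

lemma energy_congr_weight (s p : ℝ) {ω ω' : Rn n → ℝ} (R : Rn n → ℝ) (G : Set (Rn n))
    (φ : Rn n → ℝ) (h : ω =ᵐ[volume] ω') : energy s p ω R G φ = energy s p ω' R G φ := by
  refine lintegral_congr fun x => lintegral_congr_ae (ae_restrict_of_ae ?_)
  filter_upwards [(quasiMeasurePreserving_sub_left_of_right_invariant volume x).ae_eq h]
    with y hy
  simp only [Function.comp_apply] at hy
  rw [hy]

/-- The part of `nbhd G E t` where `R > 3 h`. -/
def highPart (G E : Set (Rn n)) (R : Rn n → ℝ) (t h : ℝ) : Set (Rn n) :=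
  nbhd G E t ∩ (G ∩ R ⁻¹' Ioi (3 * h))

lemma isOpen_nbhd {G : Set (Rn n)} (hG : IsOpen G) (E : Set (Rn n)) (t : ℝ) :
    IsOpen (nbhd G E t) :=
  hG.inter (isOpen_lt (Metric.continuous_infDist_pt E) continuous_const)

lemma isOpen_highPart {G : Set (Rn n)} (hG : IsOpen G) (E : Set (Rn n)) {R : Rn n → ℝ}
    (hR : ContinuousOn R G) (t h : ℝ) : IsOpen (highPart G E R t h) :=
  (isOpen_nbhd hG E t).inter (hR.isOpen_inter_preimage hG isOpen_Ioi)

lemma integrand_mul_cutoff_le {s p : ℝ} (hs : 0 < s) (hs1 : s < 1) (hp : 1 < p) {ω R : Rn n → ℝ}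
    {E G : Set (Rn n)} {t h : ℝ} (hh : 0 < h) {φ : Rn n → ℝ}
    (hφ : ∀ x ∈ G \ nbhd G E t, φ x = 0) {x y : Rn n} (hx : x ∈ G) (hy : y ∈ G) :
    ENNReal.ofReal (|φ x * cutoff h (R x) - φ y * cutoff h (R y)| ^ p /
        (‖x - y‖ + |R x - R y|) ^ (s * p) * ω (x - y)) ≤
      ENNReal.ofReal (2 ^ p) *
        (ENNReal.ofReal (|φ x - φ y| ^ p / ‖x - y‖ ^ (s * p)) * ENNReal.ofReal (ω (x - y)) +
        (ENNReal.ofReal (|φ y| ^ p) * (highPart G E R t h).indicator (fun x =>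
          ENNReal.ofReal ((max h ‖x - y‖) ^ (s * p))⁻¹ * ENNReal.ofReal (ω (x - y))) x +
        ENNReal.ofReal (|φ x| ^ p) * (highPart G E R t h).indicator (fun y =>
          ENNReal.ofReal ((max h ‖y - x‖) ^ (s * p))⁻¹ * ENNReal.ofReal (ω (x - y))) y)) := by
  have hq : 0 < s * p := by positivity
  have hqp : s * p ≤ p := by nlinarith
  have hp0 : 0 < p := by linarith
  set d := ‖x - y‖ with hd
  have hd0 : d = 0 → φ x = φ y := fun h => by rw [sub_eq_zero.1 (norm_eq_zero.1 h)]
  set δ := |R x - R y| with hδ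
  have hδ0 : 0 ≤ δ := abs_nonneg _
  have hd0' : 0 ≤ d := norm_nonneg _
  rw [ENNReal.ofReal_mul (by positivity)]
  set W := ENNReal.ofReal (ω (x - y))
  -- Off `highPart` the cutoff leaves `φ` unchanged, so no error arises. Otherwise the product rule
  -- is arranged so that `φ` is evaluated at the other point, free for the integration over
  -- `highPart`.
  have main : |φ x * cutoff h (R x) - φ y * cutoff h (R y)| ^ p / (d + δ) ^ (s * p) ≤
        2 ^ p * (|φ x - φ y| ^ p / d ^ (s * p)) ∨
      (x ∈ highPart G E R t h ∧
        |φ x * cutoff h (R x) - φ y * cutoff h (R y)| ^ p / (d + δ) ^ (s * p) ≤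
        2 ^ p * (|φ x - φ y| ^ p / d ^ (s * p) + |φ y| ^ p * ((max h d) ^ (s * p))⁻¹)) ∨
      (y ∈ highPart G E R t h ∧
        |φ x * cutoff h (R x) - φ y * cutoff h (R y)| ^ p / (d + δ) ^ (s * p) ≤
        2 ^ p * (|φ x - φ y| ^ p / d ^ (s * p) + |φ x| ^ p * ((max h d) ^ (s * p))⁻¹)) := by
    by_cases hxD : x ∈ highPart G E R t h
    · exact Or.inr (Or.inl ⟨hxD, rpow_abs_sub_mul_div_le hq hqp hp0 hh hd0' hδ0 hd0
        (cutoff_nonneg _ _) (cutoff_le_one _ _) (abs_cutoff_sub_le_one _ _ _)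
        (abs_cutoff_sub_mul_le hh _ _)⟩)
    by_cases hyD : y ∈ highPart G E R t h
    · have := rpow_abs_sub_mul_div_le hq hqp hp0 hh hd0' hδ0 (fun h => (hd0 h).symm)
        (cutoff_nonneg h (R y)) (cutoff_le_one _ _) (abs_cutoff_sub_le_one h (R y) (R x))
        (by rw [hδ, abs_sub_comm (R x)]; exact abs_cutoff_sub_mul_le hh _ _)
      rw [abs_sub_comm (φ y * _), abs_sub_comm (φ y)] at this
      exact Or.inr (Or.inr ⟨hyD, this⟩)
    refine Or.inl ?_
    have low : ∀ z ∈ G, z ∉ highPart G E R t h → φ z * cutoff h (R z) = φ z := by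
      intro z hz hzD
      by_cases hzE : z ∈ nbhd G E t
      · rw [cutoff_eq_one hh, mul_one]
        by_contra hR
        exact hzD ⟨hzE, hz, not_le.1 hR⟩
      · rw [hφ z ⟨hz, hzE⟩, zero_mul]
    rw [low x hx hxD, low y hy hyD]
    have h3 : |φ x - φ y| ^ p / (d + δ) ^ (s * p) ≤ |φ x - φ y| ^ p / d ^ (s * p) := by
      rcases hd0'.eq_or_lt with h0 | h0
      · rw [hd0 h0.symm]; simp [Real.zero_rpow hp0.ne']
      · gcongr; linarith
    refine h3.trans (le_mul_of_one_le_left (by positivity) ?_)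
    exact Real.one_le_rpow (by norm_num) hp0.le
  rcases main with h1 | ⟨hxD, h1⟩ | ⟨hyD, h1⟩
  · calc _ ≤ ENNReal.ofReal (2 ^ p * (|φ x - φ y| ^ p / d ^ (s * p))) * W := by gcongr
      _ = ENNReal.ofReal (2 ^ p) * (ENNReal.ofReal (|φ x - φ y| ^ p / d ^ (s * p)) * W) := by
        rw [ENNReal.ofReal_mul (by positivity), mul_assoc]
      _ ≤ _ := by gcongr; exact le_self_add
  · rw [indicator_of_mem hxD]
    calc _ ≤ ENNReal.ofReal (2 ^ p * (|φ x - φ y| ^ p / d ^ (s * p) +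
            |φ y| ^ p * ((max h d) ^ (s * p))⁻¹)) * W := by gcongr
      _ = ENNReal.ofReal (2 ^ p) * (ENNReal.ofReal (|φ x - φ y| ^ p / d ^ (s * p)) * W +
          ENNReal.ofReal (|φ y| ^ p) * (ENNReal.ofReal ((max h d) ^ (s * p))⁻¹ * W)) := by
        rw [ENNReal.ofReal_mul (by positivity), ENNReal.ofReal_add (by positivity) (by positivity),
          ENNReal.ofReal_mul (p := |φ y| ^ p) (by positivity)]
        ring
      _ ≤ _ := by gcongr; exact le_self_add
  · rw [indicator_of_mem hyD, norm_sub_rev y x, ← hd]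
    calc _ ≤ ENNReal.ofReal (2 ^ p * (|φ x - φ y| ^ p / d ^ (s * p) +
            |φ x| ^ p * ((max h d) ^ (s * p))⁻¹)) * W := by gcongr
      _ = ENNReal.ofReal (2 ^ p) * (ENNReal.ofReal (|φ x - φ y| ^ p / d ^ (s * p)) * W +
          ENNReal.ofReal (|φ x| ^ p) * (ENNReal.ofReal ((max h d) ^ (s * p))⁻¹ * W)) := by
        rw [ENNReal.ofReal_mul (by positivity), ENNReal.ofReal_add (by positivity) (by positivity),
          ENNReal.ofReal_mul (p := |φ x| ^ p) (by positivity)]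
        ring
      _ ≤ _ := by gcongr; exact le_add_self

/-- The error term at a fixed point, moved to the holes. -/
lemma rpow_mul_lintegral_indicator_le {s p A κ t : ℝ} (hs : 0 < s) (hs1 : s < 1) (hp : 1 < p)
    {w : Rn n → ENNReal} (hw : Measurable w) (hdb : CubeDoubling p A w)
    {E G : Set (Rn n)} {R φ : Rn n → ℝ}
    (hE : IsPorous κ E) (hne : E.Nonempty) (hc : IsCompact E) (hG : IsOpen G)
    (hRc : ContinuousOn R G) (hR : ∀ x ∈ G, R x ≤ Metric.infDist x (frontier G))
    (ht : 0 < t) (htd : t < κ * Metric.diam E / 4)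
    (hφ : ∀ x ∈ G \ nbhd G E t, φ x = 0) {y : Rn n} (hy : y ∈ G) :
    ENNReal.ofReal (|φ y| ^ p) * ∫⁻ x in G, (highPart G E R t (t / κ)).indicator (fun x =>
        ENNReal.ofReal ((max (t / κ) ‖x - y‖) ^ (s * p))⁻¹ * w x) x ≤
      ENNReal.ofReal (holeConst n p A κ) * 4 ^ n *
        ∫⁻ z in G, ENNReal.ofReal (|φ z - φ y| ^ p / ‖z - y‖ ^ (s * p)) * w z := by
  have hp0 : 0 < p := by linarith
  -- Outside `E_t` the factor `φ y` is zero; inside, `y` is not in any hole, as the kernel estimate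
  -- requires.
  by_cases hyE : y ∈ nbhd G E t
  swap
  · simp [hφ y ⟨hy, hyE⟩, Real.zero_rpow hp0.ne']
  have hH : MeasurableSet (G \ nbhd G E t) := hG.measurableSet.diff (isOpen_nbhd hG E t).measurableSet
  have hD := (isOpen_highPart hG E hRc t (t / κ)).measurableSet
  have key := setLIntegral_kernel_le_of_holes (q := s * p) (by positivity) (by nlinarith)
    hE.1 hE.2.1.le ht hw hdb hD hH (fun x hx => hE.exists_ball_subset_diff_nbhd hne hc hG ht
      htd hx.1 (lt_of_lt_of_le hx.2.2 (hR x hx.2.1))) (y := y) (fun h => h.2 hyE)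
  rw [setLIntegral_indicator hD, inter_eq_self_of_subset_left fun x hx => hx.2.1]
  calc _ ≤ ENNReal.ofReal (|φ y| ^ p) * (ENNReal.ofReal (holeConst n p A κ) * 4 ^ n *
        ∫⁻ z in G \ nbhd G E t, ENNReal.ofReal (‖z - y‖ ^ (s * p))⁻¹ * w z) := by gcongr
    _ = ENNReal.ofReal (holeConst n p A κ) * 4 ^ n * ∫⁻ z in G \ nbhd G E t,
        ENNReal.ofReal (|φ y| ^ p) * (ENNReal.ofReal (‖z - y‖ ^ (s * p))⁻¹ * w z) := by
        rw [lintegral_const_mul _ (by fun_prop)]; ring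
    _ = ENNReal.ofReal (holeConst n p A κ) * 4 ^ n * ∫⁻ z in G \ nbhd G E t,
        ENNReal.ofReal (|φ z - φ y| ^ p / ‖z - y‖ ^ (s * p)) * w z := by
        congr 1
        refine setLIntegral_congr_fun hH fun z hz => ?_
        simp only [hφ z hz, zero_sub, abs_neg]
        rw [← mul_assoc, ← ENNReal.ofReal_mul (by positivity), div_eq_mul_inv]
    _ ≤ _ := by
        gcongr _ * ?_
        exact lintegral_mono_set sdiff_subset

lemma lintegral_lintegral_const_mul_add_add {α β : Type*} [MeasurableSpace α] [MeasurableSpace β]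
    {μ : Measure α} {ν : Measure β} [SFinite ν] {e f g : α → β → ENNReal}
    (he : Measurable (Function.uncurry e)) (hf : Measurable (Function.uncurry f)) {c : ENNReal}
    (hc : c ≠ ⊤) :
    ∫⁻ x, ∫⁻ y, c * (e x y + (f x y + g x y)) ∂ν ∂μ =
      c * ((∫⁻ x, ∫⁻ y, e x y ∂ν ∂μ) + ((∫⁻ x, ∫⁻ y, f x y ∂ν ∂μ) +
        ∫⁻ x, ∫⁻ y, g x y ∂ν ∂μ)) := by
  have h1 : ∀ x, ∫⁻ y, c * (e x y + (f x y + g x y)) ∂ν =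
      c * ((∫⁻ y, e x y ∂ν) + ((∫⁻ y, f x y ∂ν) + ∫⁻ y, g x y ∂ν)) := fun x => by
    have hex : Measurable (e x) := he.comp measurable_prodMk_left
    have hfx : Measurable (f x) := hf.comp measurable_prodMk_left
    rw [lintegral_const_mul' _ _ hc, lintegral_add_left hex, lintegral_add_left hfx]
  have hE : Measurable fun x => ∫⁻ y, e x y ∂ν := he.lintegral_prod_right'
  have hF : Measurable fun x => ∫⁻ y, f x y ∂ν := hf.lintegral_prod_right'
  simp only [h1]
  rw [lintegral_const_mul' _ _ hc, lintegral_add_left hE, lintegral_add_left hF]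

lemma energy_mul_cutoff_le {s p A κ t : ℝ} (hs : 0 < s) (hs1 : s < 1) (hp : 1 < p)
    {ω : Rn n → ℝ} (hω : Measurable ω)
    (hdb : CubeDoubling p A fun x => ENNReal.ofReal (ω x)) {E G : Set (Rn n)} {R φ : Rn n → ℝ}
    (hE : IsPorous κ E) (hne : E.Nonempty) (hc : IsCompact E) (hG : IsOpen G)
    (hRc : ContinuousOn R G) (hR : ∀ x ∈ G, R x ≤ Metric.infDist x (frontier G))
    (ht : 0 < t) (htd : t < κ * Metric.diam E / 4) (hφm : Measurable φ)
    (hφ : ∀ x ∈ G \ nbhd G E t, φ x = 0) :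
    energy s p ω R G (fun x => φ x * cutoff (t / κ) (R x)) ≤
      ENNReal.ofReal (2 ^ p) * (1 + 2 * (ENNReal.ofReal (holeConst n p A κ) * 4 ^ n)) *
        energy s p ω (fun _ => 0) G φ := by
  have hh : 0 < t / κ := div_pos ht hE.1
  have hD := (isOpen_highPart hG E hRc t (t / κ)).measurableSet
  set K := ENNReal.ofReal (holeConst n p A κ) * 4 ^ n
  have hKt : K ≠ ⊤ := ENNReal.mul_ne_top ENNReal.ofReal_ne_top (by simp)
  let e : Rn n → Rn n → ENNReal := fun x y =>
    ENNReal.ofReal (|φ x - φ y| ^ p / ‖x - y‖ ^ (s * p)) * ENNReal.ofReal (ω (x - y))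
  let f : Rn n → Rn n → ENNReal := fun x y =>
    ENNReal.ofReal (|φ y| ^ p) * (highPart G E R t (t / κ)).indicator (fun x =>
      ENNReal.ofReal ((max (t / κ) ‖x - y‖) ^ (s * p))⁻¹ * ENNReal.ofReal (ω (x - y))) x
  let g : Rn n → Rn n → ENNReal := fun x y =>
    ENNReal.ofReal (|φ x| ^ p) * (highPart G E R t (t / κ)).indicator (fun y =>
      ENNReal.ofReal ((max (t / κ) ‖y - x‖) ^ (s * p))⁻¹ * ENNReal.ofReal (ω (x - y))) y
  have he : Measurable (Function.uncurry e) := by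
    simp only [e, Function.uncurry_def]; fun_prop
  have hf : Measurable (Function.uncurry f) := by
    have : Function.uncurry f = fun q : Rn n × Rn n => ENNReal.ofReal (|φ q.2| ^ p) *
        (Prod.fst ⁻¹' highPart G E R t (t / κ)).indicator (fun q : Rn n × Rn n =>
          ENNReal.ofReal ((max (t / κ) ‖q.1 - q.2‖) ^ (s * p))⁻¹ *
            ENNReal.ofReal (ω (q.1 - q.2))) q := by
      ext ⟨x, y⟩; rfl
    rw [this]
    exact Measurable.mul (by fun_prop) (Measurable.indicator (by fun_prop) (measurable_fst hD))
  have hTe : ∫⁻ x in G, ∫⁻ y in G, e x y = energy s p ω (fun _ => 0) G φ :=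
    (energy_zero_eq s p ω G φ).symm
  have hTf : ∫⁻ x in G, ∫⁻ y in G, f x y ≤ K * energy s p ω (fun _ => 0) G φ := by
    -- The estimate at a fixed point integrates over `highPart` in `x` here, so the order is
    -- exchanged; the term `g` already has the right order.
    rw [lintegral_lintegral_swap hf.aemeasurable, ← hTe,
      lintegral_lintegral_swap he.aemeasurable, ← lintegral_const_mul' _ _ hKt]
    refine setLIntegral_mono' hG.measurableSet fun y hy => ?_
    rw [lintegral_const_mul' _ _ ENNReal.ofReal_ne_top]
    exact rpow_mul_lintegral_indicator_le hs hs1 hp (by fun_prop) (hdb.comp_sub_right y)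
      hE hne hc hG hRc hR ht htd hφ hy
  have hTg : ∫⁻ x in G, ∫⁻ y in G, g x y ≤ K * energy s p ω (fun _ => 0) G φ := by
    rw [← hTe, ← lintegral_const_mul' _ _ hKt]
    refine setLIntegral_mono' hG.measurableSet fun x hx => ?_
    rw [lintegral_const_mul' _ _ ENNReal.ofReal_ne_top]
    refine (rpow_mul_lintegral_indicator_le hs hs1 hp (w := fun y => ENNReal.ofReal (ω (x - y)))
      (by fun_prop) (hdb.comp_sub_left x) hE hne hc hG hRc hR ht htd hφ hx).trans_eq ?_
    simp only [e, abs_sub_comm (φ x), norm_sub_rev x]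
    rfl
  calc energy s p ω R G (fun x => φ x * cutoff (t / κ) (R x))
      ≤ ∫⁻ x in G, ∫⁻ y in G, ENNReal.ofReal (2 ^ p) * (e x y + (f x y + g x y)) :=
        setLIntegral_mono' hG.measurableSet fun x hx => setLIntegral_mono' hG.measurableSet
          fun y hy => integrand_mul_cutoff_le hs hs1 hp hh hφ hx hy
    _ = ENNReal.ofReal (2 ^ p) * ((∫⁻ x in G, ∫⁻ y in G, e x y) +
        ((∫⁻ x in G, ∫⁻ y in G, f x y) + ∫⁻ x in G, ∫⁻ y in G, g x y)) :=
        lintegral_lintegral_const_mul_add_add he hf ENNReal.ofReal_ne_top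
    _ ≤ ENNReal.ofReal (2 ^ p) * (energy s p ω (fun _ => 0) G φ +
        (K * energy s p ω (fun _ => 0) G φ + K * energy s p ω (fun _ => 0) G φ)) := by
        rw [hTe]; gcongr
    _ = _ := by ring

lemma Admissible.mul_cutoff {E G H : Set (Rn n)} {R φ : Rn n → ℝ} {h : ℝ} (hh : 0 < h)
    (hφ : Admissible E H G φ) (hR : ContinuousOn R G) (hRE : ∀ x ∈ E, R x = 0) :
    Admissible E (H ∩ sublevel G R (4 * h)) G (fun x => φ x * cutoff h (R x)) := by
  obtain ⟨⟨h1, h2, h3⟩, h4, h5⟩ := hφ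
  have hsub : closure {x | x ∈ G ∧ φ x * cutoff h (R x) ≠ 0} ⊆ closure {x | x ∈ G ∧ φ x ≠ 0} :=
    closure_mono fun x hx => ⟨hx.1, left_ne_zero_of_mul hx.2⟩
  refine ⟨⟨h1.mul ((continuous_cutoff h).comp_continuousOn hR),
    h2.of_isClosed_subset isClosed_closure hsub, hsub.trans h3⟩, fun x hx => ?_, fun x hx => ?_⟩
  · beta_reduce
    rw [hRE x hx, cutoff_eq_one hh (by positivity), mul_one]
    exact h4 x hx
  · beta_reduce
    by_cases hxH : x ∈ H
    · rw [cutoff_eq_zero hh, mul_zero]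
      by_contra hlt
      exact hx.2 ⟨hxH, hx.1, not_le.1 hlt⟩
    · rw [h5 x ⟨hx.1, hxH⟩, zero_mul]

/-! ### Constants and conclusion. -/

/-- The `κ`-free part of the constant. -/
def capConst (n : ℕ) (p A : ℝ) : ℝ :=
  2 ^ p * (1 + 2 * (holeConst n p (|A| + 1) 1 * 4 ^ n))

lemma holeConst_pos (n : ℕ) {p A κ : ℝ} (hA : 0 < A) (hκ : 0 < κ) : 0 < holeConst n p A κ := by
  unfold holeConst; positivity

lemma capConst_pos (n : ℕ) (p A : ℝ) : 0 < capConst n p A := by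
  have := holeConst_pos n (p := p) (show 0 < |A| + 1 by positivity) one_pos
  unfold capConst
  positivity

lemma holeConst_eq (n : ℕ) (p A : ℝ) {κ : ℝ} (hκ : 0 < κ) :
    holeConst n p A κ = κ ^ (-((n : ℝ) * p)) * holeConst n p A 1 := by
  have : ((4 * (n + 1 : ℝ) / κ) ^ n) ^ p =
      κ ^ (-((n : ℝ) * p)) * ((4 * (n + 1 : ℝ) / 1) ^ n) ^ p := by
    rw [div_one, div_pow, Real.div_rpow (by positivity) (by positivity), Real.rpow_neg hκ.le,
      Real.rpow_mul hκ.le, Real.rpow_natCast]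
    ring
  rw [holeConst, holeConst, this]; ring

lemma two_rpow_mul_holeConst_le {n : ℕ} {p A a κ : ℝ} (hp : 0 ≤ p) (hA : 0 < A) (hAa : A ≤ |a| + 1)
    (hκ : 0 < κ) (hκ1 : κ ≤ 1) :
    ENNReal.ofReal (2 ^ p) * (1 + 2 * (ENNReal.ofReal (holeConst n p A κ) * 4 ^ n)) ≤
      ENNReal.ofReal (κ ^ (-((n : ℝ) * p)) * capConst n p a) := by
  have e : ENNReal.ofReal (2 ^ p) * (1 + 2 * (ENNReal.ofReal (holeConst n p A κ) * 4 ^ n)) =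
      ENNReal.ofReal (2 ^ p * (1 + 2 * (holeConst n p A κ * 4 ^ n))) := by
    have := holeConst_pos n (p := p) hA hκ
    rw [ENNReal.ofReal_mul (by positivity), ENNReal.ofReal_add (by positivity) (by positivity),
      ENNReal.ofReal_mul (by positivity), ENNReal.ofReal_mul this.le, ENNReal.ofReal_pow (by positivity)]
    simp
  rw [e]
  refine ENNReal.ofReal_le_ofReal ?_
  -- Lets the summand `1`, which comes from the energy of `φ` itself, be absorbed into `κ ^ (-np)`.
  have h1 : 1 ≤ κ ^ (-((n : ℝ) * p)) :=
    Real.one_le_rpow_of_pos_of_le_one_of_nonpos hκ hκ1 (by simp; positivity)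
  have h2 : holeConst n p A 1 ≤ holeConst n p (|a| + 1) 1 := by
    unfold holeConst; gcongr
  have h3 := holeConst_pos n (p := p) hA one_pos
  rw [holeConst_eq n p A hκ, capConst]
  calc (2 : ℝ) ^ p * (1 + 2 * (κ ^ (-((n : ℝ) * p)) * holeConst n p A 1 * 4 ^ n))
      ≤ 2 ^ p * (κ ^ (-((n : ℝ) * p)) +
          2 * (κ ^ (-((n : ℝ) * p)) * holeConst n p (|a| + 1) 1 * 4 ^ n)) := by gcongr
    _ = _ := by ring

/-- An admissible bound within `1` of the infimum suffices, so attainment is not needed; the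
absolute value keeps `capConst` positive for every real argument. -/
lemma exists_apBound_le {p : ℝ} {ω : Rn n → ℝ} (h : IsApWeight p ω) :
    ∃ A, 0 < A ∧ ApBound p ω A ∧ A ≤ |apConst p ω| + 1 := by
  obtain ⟨A, hA, hlt⟩ := exists_lt_of_csInf_lt (s := {A : ℝ | 0 < A ∧ ApBound p ω A}) h.2
    (lt_add_one (apConst p ω))
  exact ⟨A, hA.1, hA.2, hlt.le.trans (by gcongr; exact le_abs_self _)⟩

end FracCap

end

theorem theorem7p3 :
    ∃ C : ℕ → ℝ → ℝ → ℝ, (∀ (n : ℕ) (p A : ℝ), 0 < C n p A) ∧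
      ∀ (n : ℕ) (s p : ℝ), 0 < s → s < 1 → 1 < p →
      ∀ ω : FracCap.Rn n → ℝ, FracCap.IsApWeight p ω →
      ∀ (κ : ℝ) (E G : Set (FracCap.Rn n)), E.Nonempty → IsCompact E → FracCap.IsPorous κ E →
        IsOpen G → Bornology.IsBounded G → E ⊆ G →
      ∀ R : FracCap.Rn n → ℝ, ContinuousOn R G → (∀ x ∈ E, R x = 0) →
        (∀ x ∈ G, 0 ≤ R x ∧ R x ≤ Metric.infDist x (frontier G)) →
      ∀ t : ℝ, 0 < t → t < κ * Metric.diam E / 4 → closure (FracCap.nbhd G E t) ⊆ G →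
        FracCap.capR s p ω R E (FracCap.nbhd G E t ∩ FracCap.sublevel G R (4 * t / κ)) G ≤
          ENNReal.ofReal (κ ^ (-((n : ℝ) * p)) * C n p (FracCap.apConst p ω)) *
            FracCap.cap s p ω E (FracCap.nbhd G E t) G := by
  refine ⟨FracCap.capConst, FracCap.capConst_pos, ?_⟩
  intro n s p hs hs1 hp ω hω κ E G hne hc hE hG _ hEG R hRc hRE hR t ht htd _
  obtain ⟨A, hA, hAp, hAle⟩ := FracCap.exists_apBound_le hω
  have hωm : AEMeasurable ω := hω.1.1.aestronglyMeasurable.aemeasurable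
  have hdb : FracCap.CubeDoubling p A fun x => ENNReal.ofReal (hωm.mk ω x) :=
    (FracCap.cubeDoubling_of_apBound hp hA hω.1 hAp).congr_ae
      (hωm.ae_eq_mk.mono fun x hx => by simp only [hx])
  have hh : 0 < t / κ := div_pos ht hE.1
  rw [FracCap.cap, FracCap.capR, FracCap.capR,
    ENNReal.mul_iInf_of_ne (ENNReal.ofReal_pos.2 ?_).ne' ENNReal.ofReal_ne_top]
  swap
  · exact mul_pos (Real.rpow_pos_of_pos hE.1 _) (FracCap.capConst_pos n p _)
  refine le_iInf fun φ => ?_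
  by_cases hφ : FracCap.Admissible E (FracCap.nbhd G E t) G φ
  swap
  · rw [iInf_neg hφ, ENNReal.mul_top (ENNReal.ofReal_pos.2 ?_).ne']
    · exact le_top
    · exact mul_pos (Real.rpow_pos_of_pos hE.1 _) (FracCap.capConst_pos n p _)
  rw [iInf_pos hφ]
  have hadm := hφ.mul_cutoff hh hRc hRE
  rw [← mul_div_assoc] at hadm
  refine (iInf₂_le _ hadm).trans ?_
  classical
  -- Only the values of `φ` on `G` are controlled. Extension by zero gives a measurable function
  -- with the same energy, and `ω` is likewise replaced by a measurable representative.
  have hφm : Measurable (G.piecewise φ 0) :=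
    hφ.1.1.measurable_piecewise continuousOn_const hG.measurableSet
  have heq : EqOn φ (G.piecewise φ 0) G := fun x hx => (piecewise_eq_of_mem G φ 0 hx).symm
  rw [FracCap.energy_congr_weight s p R G _ hωm.ae_eq_mk,
    FracCap.energy_congr_weight s p _ G _ hωm.ae_eq_mk,
    FracCap.energy_congr_fun s p _ R hG.measurableSet
      (φ' := fun x => G.piecewise φ 0 x * FracCap.cutoff (t / κ) (R x))
      (fun x hx => by simp only [heq hx]),
    FracCap.energy_congr_fun s p _ _ hG.measurableSet heq]
  refine (FracCap.energy_mul_cutoff_le hs hs1 hp hωm.measurable_mk hdb hE hne hc hG hRc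
    (fun x hx => (hR x hx).2) ht htd hφm
    (fun x hx => by rw [← heq hx.1, hφ.2.2 x hx])).trans ?_
  gcongr
  exact FracCap.two_rpow_mul_holeConst_le (by linarith) hA hAle hE.1 hE.2.1.le
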